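/- Let $N\ge 2$, $0\le n\le N$, $\mathbf P=\mathbb C[t_1,\dots,t_N]$, and let $\Lambda_n$ be the set of words $\lambda\in\{0,1\}^N$ with exactly $n$ letters $1$. The group $S_N$ acts on $\Lambda_n$ by $(w\lambda)_j=\lambda_{w^{-1}(j)}$. Let $\ell(\lambda)=\#\{i<j : \lambda_i>\lambda_j\}$. Write $\mu\ge\lambda$ if $\sum_{i\le j}\mu_i\ge\sum_{i\le j}\lambda_i$ for all $j$, and $\mu\ge_w\lambda$ if $w^{-1}\mu\ge w^{-1}\lambda$. Via restriction to torus fixed points, the $T$-equivariant cohomology $H_T^*(\mathrm{Gr}(n,N))$ (coefficients in $\mathbb C$) is identified with the $\mathbf P$-module of all functions $\alpha:\Lambda_n\to\mathbf P$ such that $t_i-t_j$ divides $\alpha(\lambda)-\alpha(s_{ij}\lambda)$ for all $\lambda\in\Lambda_n$ and all transpositions $s_{ij}$. For $w\in S_N$ and $\lambda\in\Lambda_n$, the $w$-twisted equivariant Schubert class $S^w_\lambda$ is the class $\alpha\in H_T^*(\mathrm{Gr}(n,N))$ such that: $\alpha(\lambda)\neq 0$, and $\alpha(\mu)=0$ unless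 $\mu\ge_w\lambda$; $\alpha(\lambda)=\prod(t_i-t_j)$, the product over all $(i,j)$ with $w^{-1}(i)<w^{-1}(j)$ and $\lambda_i>\lambda_j$; and $\deg\alpha(\mu)=\ell(w^{-1}\lambda)$ for all $\mu\ge_w\lambda$. Then the following hold. 1. For all $w\in S_N$ and $\lambda\in\Lambda_n$ there is exactly one such class $S^w_\lambda$. 2. For all $w\in S_N$, all simple transpositions $s=s_i=(i,i+1)$ and all $\lambda,\mu\in\Lambda_n$, $$S^{ws}_\lambda(\mu)=\begin{cases}S^w_{wsw^{-1}(\lambda)}(\mu)+(t_{w(i+1)}-t_{w(i)})\,S^w_\lambda(\mu)&\text{if }\lambda_{w(i+1)}>\lambda_{w(i)},\\ S^w_{wsw^{-1}(\lambda)}(\mu)&\text{otherwise.}\end{cases}$$ 3. For every $w\in S_N$, the family $\{S^w_\lambda\}_{\lambda\in\Lambda_n}$ is a $\mathbf P$-basis of $H_T^*(\mathrm{Gr}(n,N))$. 4. Let $V=\mathbb C^2$ with basis $v_0,v_1$, and let $v_\lambda=v_{\lambda_1}\otimes\cdots\otimes v_{\lambda_N}\in V^{\otimes N}\otimes\mathbf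 P$ for $\lambda\in\{0,1\}^N$. In the ordered basis $v_0\otimes v_0,\ v_0\otimes v_1,\ v_1\otimes v_0,\ v_1\otimes v_1$ of $V\otimes V$ let $$R(x,y)=\begin{pmatrix}1&0&0&0\\0&x-y&1&0\\0&1&0&0\\0&0&0&1\end{pmatrix}.$$ For $w\in S_N$ and $1\le i\le N-1$ put $a=w(i)$, $b=w(i+1)$, and let $R_{a,b}(t_b,t_a)$ be $R(t_b,t_a)$ acting on the $a$-th (first) and $b$-th (second) tensor factors of $V^{\otimes N}\otimes\mathbf P$. Then the base change from $\{S^{ws_i}_\lambda\}$ to $\{S^w_\lambda\}$ is given by $R_{a,b}(t_b,t_a)$: if $S^{ws_i}_\lambda=\sum_{\mu\in\Lambda_n}c_{\mu\lambda}S^w_\mu$ with $c_{\mu\lambda}\in\mathbf P$, then $R_{a,b}(t_b,t_a)\,v_\lambda=\sum_{\mu\in\Lambda_n}c_{\mu\lambda}v_\mu$ for all $\lambda\in\Lambda_n$. -/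

import Mathlib

open scoped TensorProduct

namespace WallCrossing

/-- The polynomial ring `P = ℂ[t_1, …, t_N]`; the variable `t_i` is `MvPolynomial.X i`.
Indices run over `Fin N`, so they start at `0`. -/
abbrev P (N : ℕ) : Type := MvPolynomial (Fin N) ℂ

/-! ### Words -/

/-- The set `Λ_n` of words `λ` of length `N` in the letters `0, 1` with exactly `n` letters `1`. -/
abbrev Word (N n : ℕ) : Type := {l : Fin N → Fin 2 // ∑ i, (l i : ℕ) = n}

/-- The action of the symmetric group on words: `(w λ)_j = λ_{w⁻¹(j)}`. -/
def Word.act {N n : ℕ} (w : Equiv.Perm (Fin N)) (l : Word N n) : Word N n :=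
  ⟨fun j => l.1 (w⁻¹ j),
    (Equiv.sum_comp (w⁻¹) (fun j => (l.1 j : ℕ))).trans l.2⟩

/-- The number `ℓ(λ)` of inversions, i.e. of pairs `i < j` with `λ_i > λ_j`. -/
def Word.length {N n : ℕ} (l : Word N n) : ℕ :=
  (Finset.univ.filter fun p : Fin N × Fin N => p.1 < p.2 ∧ l.1 p.2 < l.1 p.1).card

/-- The twisted inversion set: pairs `(i, j)` with `w⁻¹(i) < w⁻¹(j)` and `λ_i > λ_j`. -/
def Word.inv {N n : ℕ} (w : Equiv.Perm (Fin N)) (l : Word N n) : Finset (Fin N × Fin N) :=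
  Finset.univ.filter fun p : Fin N × Fin N => w⁻¹ p.1 < w⁻¹ p.2 ∧ l.1 p.2 < l.1 p.1

/-- The order `μ ≥ λ` : every initial segment of `μ` has at least as many letters `1` as the one
of `λ`. -/
def Word.GE {N n : ℕ} (m l : Word N n) : Prop :=
  ∀ j : Fin N, ∑ i ∈ Finset.Iic j, (l.1 i : ℕ) ≤ ∑ i ∈ Finset.Iic j, (m.1 i : ℕ)

/-- The twisted order: `μ ≥_w λ` iff `w⁻¹(μ) ≥ w⁻¹(λ)`. -/
def Word.twistedGE {N n : ℕ} (w : Equiv.Perm (Fin N)) (m l : Word N n) : Prop :=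
  Word.GE (Word.act w⁻¹ m) (Word.act w⁻¹ l)

/-! ### Equivariant cohomology of the Grassmannian and twisted Schubert classes -/

/-- The `T`-equivariant cohomology `H_T^*(Gr(n, N))`, seen through restriction to the torus fixed
points `ℂ^λ` as the `P`-module of the functions `Λ_n → P` that satisfy the
Goresky–Kottwitz–MacPherson conditions. -/
def HT (N n : ℕ) : Submodule (P N) (Word N n → P N) where
  carrier := {α | ∀ (i j : Fin N), i ≠ j → ∀ l : Word N n,
    (MvPolynomial.X i - MvPolynomial.X j : P N) ∣ α l - α (Word.act (Equiv.swap i j) l)}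
  zero_mem' := fun i j _ l => by simp
  add_mem' := fun {α β} hα hβ i j hij l => by
    have h := dvd_add (hα i j hij l) (hβ i j hij l)
    have e : (α + β) l - (α + β) (Word.act (Equiv.swap i j) l)
        = (α l - α (Word.act (Equiv.swap i j) l)) + (β l - β (Word.act (Equiv.swap i j) l)) := by
      simp only [Pi.add_apply]; ring
    rw [e]; exact h
  smul_mem' := fun c α hα i j hij l => by
    have h := Dvd.dvd.mul_left (hα i j hij l) c
    have e : (c • α) l - (c • α) (Word.act (Equiv.swap i j) l)
        = c * (α l - α (Word.act (Equiv.swap i j) l)) := by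
      simp only [Pi.smul_apply, smul_eq_mul]; ring
    rw [e]; exact h

/-- `α` has `w`-support above `λ`: it does not vanish at `λ`, and it vanishes at every `μ` that
does not satisfy `μ ≥_w λ`. -/
def HasSupportAbove {N n : ℕ} (w : Equiv.Perm (Fin N)) (l : Word N n) (α : Word N n → P N) : Prop :=
  α l ≠ 0 ∧ ∀ m, α m ≠ 0 → Word.twistedGE w m l

/-- The conditions that characterise the `w`-twisted equivariant Schubert class of `λ`: it is a
class, it has `w`-support above `λ`, its value at `λ` is the product of the weights `t_i - t_j`
over the twisted inversions, and its values above `λ` have degree `ℓ(w⁻¹ λ)`. -/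
structure IsTwistedSchubertClass {N n : ℕ} (w : Equiv.Perm (Fin N)) (l : Word N n)
    (α : Word N n → P N) : Prop where
  isClass : α ∈ HT N n
  support : HasSupportAbove w l α
  value : α l = ∏ p ∈ Word.inv w l, (MvPolynomial.X p.1 - MvPolynomial.X p.2)
  degree : ∀ m, Word.twistedGE w m l →
    (α m).totalDegree = Word.length (Word.act w⁻¹ l)

/-- The `w`-twisted equivariant Schubert class `S^w_λ`: the function with the properties listed in
`IsTwistedSchubertClass`. -/
noncomputable def S {N n : ℕ} (w : Equiv.Perm (Fin N)) (l : Word N n) : Word N n → P N :=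
  Classical.epsilon fun α => IsTwistedSchubertClass w l α

/-! ### The `R`-matrix -/

/-- The `R`-matrix `R(x, y)` in the ordered basis
`v_0 ⊗ v_0, v_0 ⊗ v_1, v_1 ⊗ v_0, v_1 ⊗ v_1` of `V ⊗ V`. -/
def RMatrix {A : Type*} [CommRing A] (x y : A) : Matrix (Fin 2 × Fin 2) (Fin 2 × Fin 2) A :=
  (!![1, 0, 0, 0;
      0, x - y, 1, 0;
      0, 1, 0, 0;
      0, 0, 0, 1] : Matrix (Fin 4) (Fin 4) A).submatrix
    (finProdFinEquiv (m := 2) (n := 2)) (finProdFinEquiv (m := 2) (n := 2))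

/-- `V^{⊗N} ⊗ P` with `V = ℂ²`, as the `N`-fold tensor power over `P` of the free module `P²`. -/
abbrev VN (N : ℕ) : Type := ⨂[P N] _ : Fin N, (Fin 2 → P N)

/-- The standard basis `v_λ = v_{λ_1} ⊗ ⋯ ⊗ v_{λ_N}`, `λ ∈ {0, 1}^N`, of `V^{⊗N} ⊗ P`. -/
noncomputable def stdBasis (N : ℕ) : Module.Basis (Fin N → Fin 2) (P N) (VN N) :=
  Basis.piTensorProduct fun _ => Pi.basisFun (P N) (Fin 2)

/-- The operator `f_a ⊗ g_b`: it acts by `f` on the tensor factor `a`, by `g` on the tensor factor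
`b` (with `a ≠ b`) and by the identity on the others. -/
noncomputable def onFactors {N : ℕ} (a b : Fin N)
    (f g : (Fin 2 → P N) →ₗ[P N] (Fin 2 → P N)) : VN N →ₗ[P N] VN N :=
  PiTensorProduct.map fun c => if c = a then f else if c = b then g else LinearMap.id

/-- For a matrix `M` of an endomorphism of `V ⊗ V`, with `M = ∑ M_{(k,l),(p,q)} E_{kp} ⊗ E_{lq}`,
the operator `M_{a,b}` that acts by `M` on the tensor factors `a` (first) and `b` (second), and by
the identity on the others. -/
noncomputable def actOnFactors {N : ℕ} (a b : Fin N)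
    (M : Matrix (Fin 2 × Fin 2) (Fin 2 × Fin 2) (P N)) : VN N →ₗ[P N] VN N :=
  ∑ k : Fin 2, ∑ l : Fin 2, ∑ p : Fin 2, ∑ q : Fin 2,
    M (k, l) (p, q) • onFactors a b
      (Matrix.toLin' (Matrix.single k p (1 : P N))) (Matrix.toLin' (Matrix.single l q (1 : P N)))

end WallCrossing

/-!
All Schubert classes come from those of the antitone words, which are supported at a single point,
by divided differences: if `s` is a simple transposition at an ascent of `l`, the class of `l` is
`(α - s α) / (t_i - t_j)`, where `α` is the class of `s l` and `s` acts on words and on variables at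
once. Uniqueness compares degrees: the difference of two classes of `l` is supported above `l`, and
its value at a point `m` of minimal length in its support is divisible by the product over the
inversions of `m`, which has degree `ℓ(m) > ℓ(l)`. The recursion for `s α` shows that each value at
`m` is homogeneous, and positive at the point `m` of `ℂ^N` if `m ≥ l`; so it has the exact degree
`ℓ(l)`.

A permutation carries the class of `w⁻¹ l` to the `w`-twisted class of `l`, which turns the formula
for `s α` into the wall-crossing relation. The coefficients of this relation are the columns of the
`R`-matrix. The twisted classes form a basis because they are triangular with respect to length,
with diagonal entries dividing every leading value of a class.
-/

namespace WallCrossing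

open Finset MvPolynomial

/-! ### Sums, triangular families, transpositions -/

theorem two_mul_sum_mul_sum_Iic {ι R : Type*} [Fintype ι] [LinearOrder ι] [LocallyFiniteOrderBot ι]
    [CommSemiring R] (f : ι → R) :
    2 * ∑ j, f j * ∑ i ∈ Iic j, f i = (∑ i, f i) ^ 2 + ∑ i, f i ^ 2 := by
  have transpose : ∑ j, f j * ∑ i ∈ Iic j, f i = ∑ j, f j * ∑ i with j ≤ i, f i := by
    simp only [mul_sum]
    rw [sum_comm' (t' := univ) (s' := fun i => {j | i ≤ j}) (by simp)]
    simp only [mul_comm]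
  have split (j : ι) : ∑ i ∈ Iic j, f i + ∑ i with j ≤ i, f i = ∑ i, f i + f j := by
    have : ({i | j ≤ i} : Finset ι) = insert j (Iic j)ᶜ := by
      ext i
      rw [mem_filter_univ, mem_insert, mem_compl, mem_Iic, not_le, le_iff_eq_or_lt, eq_comm]
    rw [this, sum_insert (by simp), add_left_comm, sum_add_sum_compl, add_comm]
  rw [two_mul]
  nth_rewrite 2 [transpose]
  simp only [← sum_add_distrib, ← mul_add, split]
  simp only [mul_add, sum_add_distrib, ← sum_mul, sq]

section Triangular

variable {ι R : Type*} [CommRing R] {b : ι → ι → R}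

theorem linearIndependent_of_triangular {κ : Type*} [LinearOrder κ] [IsDomain R] {rank : ι → κ}
    (triangular : ∀ i j, rank j ≤ rank i → j ≠ i → b i j = 0) (diag_ne_zero : ∀ i, b i i ≠ 0) :
    LinearIndependent R b := by
  rw [linearIndependent_iff]
  intro c hc
  by_contra hne
  obtain ⟨i, hi, hmin⟩ := exists_min_image c.support rank (Finsupp.support_nonempty_iff.2 hne)
  have hval : c i * b i i = 0 := by
    have := congrFun hc i
    rwa [Finsupp.linearCombination_apply, Finsupp.sum, Finset.sum_apply,
      sum_eq_single_of_mem i hi fun k hk hki => by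
        simp [triangular k i (hmin k hk) hki.symm]] at this
  exact mul_ne_zero (Finsupp.mem_support_iff.1 hi) (diag_ne_zero i) hval

theorem le_span_range_of_triangular [Finite ι] {rank : ι → ℕ} {M : Submodule R (ι → R)}
    (triangular : ∀ i j, rank j ≤ rank i → j ≠ i → b i j = 0) (mem : ∀ i, b i ∈ M)
    (diag_dvd : ∀ x ∈ M, ∀ i, (∀ j, rank j < rank i → x j = 0) → b i i ∣ x i) :
    M ≤ Submodule.span R (Set.range b) := by
  have := Fintype.ofFinite ι
  intro x hx
  have approx (k : ℕ) : ∃ y ∈ Submodule.span R (Set.range b), ∀ j, rank j < k → x j = y j := by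
    induction k with
    | zero => exact ⟨0, zero_mem _, by simp⟩
    | succ k ih =>
      obtain ⟨y, hy, hxy⟩ := ih
      have hyM : y ∈ M := Submodule.span_le.2 (Set.range_subset_iff.2 mem) hy
      choose! q hq using fun i (hi : rank i = k) =>
        diag_dvd (x - y) (sub_mem hx hyM) i fun j hj => sub_eq_zero.2 (hxy j (hi ▸ hj))
      refine ⟨y + ∑ i with rank i = k, q i • b i, add_mem hy <| sum_mem fun i _ =>
        Submodule.smul_mem _ _ <| Submodule.subset_span ⟨i, rfl⟩, fun j hj => ?_⟩
      have off_diag (i : ι) (hi : rank i = k) (hij : i ≠ j) : q i * b i j = 0 := by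
        rw [triangular i j (by omega) hij.symm, mul_zero]
      simp only [Pi.add_apply, Finset.sum_apply, Pi.smul_apply, smul_eq_mul]
      rcases Nat.lt_succ_iff_lt_or_eq.1 hj with hj | hj
      · rw [hxy j hj, sum_eq_zero, add_zero]
        exact fun i hi => off_diag i (mem_filter.1 hi).2 fun h => by simp_all
      · rw [sum_eq_single_of_mem j (by simpa using hj)
          fun i hi => off_diag i (mem_filter.1 hi).2, mul_comm, ← hq j hj]
        simp
  obtain ⟨y, hy, hxy⟩ := approx (∑ i, rank i + 1)
  have : x = y := funext fun j =>
    hxy j (Nat.lt_succ_of_le (single_le_sum (fun _ _ => Nat.zero_le _) (mem_univ j)))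
  exact this ▸ hy

end Triangular

theorem swap_lt_swap_iff_of_covBy {α : Type*} [LinearOrder α] {i j a b : α} (hij : i ⋖ j) :
    Equiv.swap i j a < Equiv.swap i j b ↔ (a = j ∧ b = i) ∨ (a < b ∧ ¬(a = i ∧ b = j)) := by
  have below {c : α} (hc : c < j) : c ≤ i := hij.le_of_lt hc
  have above {c : α} (hc : i < c) : j ≤ c := hij.ge_of_gt hc
  have := hij.lt
  rw [Equiv.swap_apply_def, Equiv.swap_apply_def]
  split_ifs <;> grind

/-! ### Divisibility by differences of variables -/

section Polynomial

variable {σ R : Type*} [CommRing R]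

theorem dvd_algHom_sub_algHom {A : Type*} [CommRing A] [Algebra R A]
    {φ ψ : MvPolynomial σ R →ₐ[R] A} {d : A}
    (h : ∀ c, d ∣ φ (X c) - ψ (X c)) (f : MvPolynomial σ R) : d ∣ φ f - ψ f := by
  simp only [← Ideal.mem_span_singleton, ← Ideal.Quotient.eq] at h ⊢
  exact DFunLike.congr_fun (algHom_ext (f := (Ideal.Quotient.mkₐ R (Ideal.span {d})).comp φ)
    (g := (Ideal.Quotient.mkₐ R (Ideal.span {d})).comp ψ) h) f

theorem X_sub_X_dvd_iff [DecidableEq σ] {a b : σ} {f : MvPolynomial σ R} :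
    (X a - X b) ∣ f ↔ aeval (Function.update X a (X b) : σ → MvPolynomial σ R) f = 0 := by
  set φ : MvPolynomial σ R →ₐ[R] MvPolynomial σ R := aeval (Function.update X a (X b))
  have dvd_sub : X a - X b ∣ f - φ f :=
    dvd_algHom_sub_algHom (φ := AlgHom.id R _) (fun c => by
      rcases eq_or_ne c a with rfl | hc <;> simp [φ, *]) f
  refine ⟨?_, fun h => by rwa [h, sub_zero] at dvd_sub⟩
  rintro ⟨g, rfl⟩
  have : φ (X b) = X b := by rcases eq_or_ne b a with rfl | hb <;> simp [φ, *]
  rw [map_mul, map_sub, this]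
  simp [φ]

theorem X_sub_X_dvd_sub_rename_swap [DecidableEq σ] (a b : σ) (f : MvPolynomial σ R) :
    (X a - X b) ∣ f - rename (Equiv.swap a b) f := by
  refine dvd_algHom_sub_algHom (φ := AlgHom.id R _) (fun c => ?_) f
  rw [AlgHom.id_apply, rename_X, Equiv.swap_apply_def]
  split_ifs with ha hb
  · rw [ha]
  · rw [hb, ← neg_sub (X a), dvd_neg]
  · simp

theorem X_sub_X_ne_zero [Nontrivial R] {a b : σ} (hab : a ≠ b) :
    (X a - X b : MvPolynomial σ R) ≠ 0 :=
  sub_ne_zero.2 (X_injective.ne hab)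

theorem prime_X_sub_X [IsDomain R] {a b : σ} (hab : a ≠ b) :
    Prime (X a - X b : MvPolynomial σ R) := by
  classical
  refine ⟨X_sub_X_ne_zero hab, fun hu => ?_, fun f g hfg => ?_⟩
  · simpa using X_sub_X_dvd_iff.1 (hu.dvd (a := 1))
  · simpa only [X_sub_X_dvd_iff, map_mul, mul_eq_zero] using hfg

theorem sym2_eq_of_X_sub_X_dvd [Nontrivial R] {a b c d : σ} (hcd : c ≠ d)
    (h : (X a - X b : MvPolynomial σ R) ∣ X c - X d) : s(a, b) = s(c, d) := by
  classical
  rw [X_sub_X_dvd_iff, map_sub, aeval_X, aeval_X, sub_eq_zero] at h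
  simp only [Function.update_apply] at h
  split_ifs at h <;> simp_all [X_injective.eq_iff]

theorem isHomogeneous_X_sub_X (a b : σ) : (X a - X b : MvPolynomial σ R).IsHomogeneous 1 :=
  (isHomogeneous_X R a).sub (isHomogeneous_X R b)

end Polynomial

/-! ### Prefix sums, order and length of words -/

variable {N n : ℕ}

namespace Word

theorem act_apply (w : Equiv.Perm (Fin N)) (l : Word N n) (j : Fin N) :
    (act w l).1 j = l.1 (w⁻¹ j) := rfl

@[simp]
theorem act_one (l : Word N n) : act 1 l = l := rfl

@[simp]
theorem act_act (w v : Equiv.Perm (Fin N)) (l : Word N n) : act w (act v l) = act (w * v) l := rfl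

theorem act_swap_act_swap (i j : Fin N) (l : Word N n) :
    act (Equiv.swap i j) (act (Equiv.swap i j) l) = l := by
  rw [act_act, Equiv.swap_mul_self, act_one]

theorem act_swap_apply_left (i j : Fin N) (l : Word N n) :
    (act (Equiv.swap i j) l).1 i = l.1 j := by
  rw [act_apply, Equiv.swap_inv, Equiv.swap_apply_left]

theorem act_swap_apply_right (i j : Fin N) (l : Word N n) :
    (act (Equiv.swap i j) l).1 j = l.1 i := by
  rw [act_apply, Equiv.swap_inv, Equiv.swap_apply_right]

theorem act_swap_apply_of_ne {i j k : Fin N} (hi : k ≠ i) (hj : k ≠ j) (l : Word N n) :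
    (act (Equiv.swap i j) l).1 k = l.1 k := by
  rw [act_apply, Equiv.swap_inv, Equiv.swap_apply_of_ne_of_ne hi hj]

theorem act_swap_of_eq {i j : Fin N} {l : Word N n} (h : l.1 i = l.1 j) :
    act (Equiv.swap i j) l = l := by
  refine Subtype.ext (funext fun k => ?_)
  rw [act_apply, Equiv.swap_inv, Equiv.swap_apply_def]
  split_ifs with hi hj
  · rw [hi, h]
  · rw [hj, h]
  · rfl

/-- The number of letters `1` among the positions up to `k`, in terms of which the order `GE` is
the pointwise one. -/
def prefixSum (l : Word N n) (k : Fin N) : ℕ := ∑ x ∈ Iic k, (l.1 x : ℕ)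

theorem prefixSum_eq_sum_Iio_add (l : Word N n) (i : Fin N) :
    l.prefixSum i = ∑ x ∈ Iio i, (l.1 x : ℕ) + l.1 i := by
  rw [prefixSum, ← Iio_insert, sum_insert (by simp), add_comm]

theorem sum_Iio_eq_prefixSum (l : Word N n) {i j : Fin N} (hij : i ⋖ j) :
    ∑ x ∈ Iio j, (l.1 x : ℕ) = l.prefixSum i := by
  have : Iio j = Iic i := coe_injective (by simpa using hij.Iio_eq)
  rw [this, prefixSum]

theorem prefixSum_act_swap (l : Word N n) {a b k : Fin N} (h : a ≤ k ↔ b ≤ k) :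
    (act (Equiv.swap a b) l).prefixSum k = l.prefixSum k := by
  refine sum_equiv (Equiv.swap a b) (fun x => ?_) fun x _ => by rw [act_apply, Equiv.swap_inv]
  rw [mem_Iic, mem_Iic, Equiv.swap_apply_def]
  split_ifs with ha hb
  · rw [ha, h]
  · rw [hb, h]
  · rfl

section Order

variable {l m p : Word N n}

theorem GE.refl (l : Word N n) : GE l l := fun _ => le_rfl

theorem GE.trans (hlm : GE l m) (hmp : GE m p) : GE l p := fun k => (hmp k).trans (hlm k)

theorem GE.sum_Iio_le (h : GE m l) (i : Fin N) :
    ∑ x ∈ Iio i, (l.1 x : ℕ) ≤ ∑ x ∈ Iio i, (m.1 x : ℕ) := by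
  by_cases hi : IsMin i
  · simp [Finset.Iio_eq_empty.2 hi]
  · simp only [sum_Iio_eq_prefixSum _ (Order.pred_covBy_of_not_isMin hi)]
    exact h _

theorem GE.antisymm (h : GE m l) (h' : GE l m) : m = l := by
  refine Subtype.ext (funext fun i => Fin.ext ?_)
  have hprefix : m.prefixSum i = l.prefixSum i := le_antisymm (h' i) (h i)
  have hIio := le_antisymm (h.sum_Iio_le i) (h'.sum_Iio_le i)
  simp only [prefixSum_eq_sum_Iio_add, hIio] at hprefix
  exact Nat.add_left_cancel hprefix

theorem ge_act_swap {a b : Fin N} (hab : a ≤ b) (hl : l.1 b ≤ l.1 a) :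
    GE l (act (Equiv.swap a b) l) := by
  intro k
  by_cases hbk : b ≤ k
  · exact (l.prefixSum_act_swap (iff_of_true (hab.trans hbk) hbk)).le
  refine sum_le_sum fun x hx => ?_
  have hxb : x ≠ b := fun h => hbk (h ▸ mem_Iic.1 hx)
  rcases eq_or_ne x a with rfl | hxa
  · rwa [act_swap_apply_left]
  · rw [act_swap_apply_of_ne hxa hxb]

theorem GE.act_swap_left {i j : Fin N} (h : GE m l) (hij : i ⋖ j) (hl : l.1 i ≤ l.1 j) :
    GE (act (Equiv.swap i j) m) l := by
  intro k
  rcases eq_or_ne k i with rfl | hki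
  · have hm := m.prefixSum_act_swap (iff_of_true hij.le le_rfl)
    have below := h.sum_Iio_le k
    have upto : l.prefixSum j ≤ m.prefixSum j := h j
    change l.prefixSum k ≤ Word.prefixSum _ k
    simp only [prefixSum_eq_sum_Iio_add _ j, sum_Iio_eq_prefixSum _ hij,
      act_swap_apply_right] at hm upto
    simp only [prefixSum_eq_sum_Iio_add l, prefixSum_eq_sum_Iio_add m] at hm upto ⊢
    omega
  · have : i ≤ k ↔ j ≤ k := ⟨fun hik => hij.ge_of_gt (hik.lt_of_ne' hki), hij.le.trans⟩
    exact (h k).trans (m.prefixSum_act_swap this).ge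

end Order

section Length

variable {l m : Word N n}

theorem length_add_sum_mul_prefixSum (l : Word N n) :
    l.length + ∑ j, (l.1 j : ℕ) * l.prefixSum j = ∑ j, l.prefixSum j := by
  have : l.length = ∑ j, ∑ i ∈ Iio j, if l.1 j < l.1 i then 1 else 0 := by
    rw [length, card_filter, ← univ_product_univ, sum_product_right]
    refine sum_congr rfl fun j _ => ?_
    rw [← filter_gt_eq_Iio, sum_filter]
    exact sum_congr rfl fun i _ => ite_and ..
  rw [this, ← sum_add_distrib]
  refine sum_congr rfl fun j _ => ?_
  rw [prefixSum_eq_sum_Iio_add]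
  obtain hj | hj : l.1 j = 0 ∨ l.1 j = 1 := by omega
  · simp only [hj, Fin.val_zero, zero_mul, add_zero]
    exact sum_congr rfl fun i _ => by split_ifs <;> omega
  · simp only [hj, Fin.val_one, one_mul, add_eq_right]
    exact sum_eq_zero fun i _ => if_neg (by omega)

-- The length is affine in the sum of the prefix sums, which makes it strictly monotone for `GE`.
theorem two_mul_length_add (l : Word N n) :
    2 * l.length + (n ^ 2 + n) = 2 * ∑ j, l.prefixSum j := by
  have letter_sq (i : Fin N) : (l.1 i : ℕ) ^ 2 = l.1 i := by
    obtain hi | hi : l.1 i = 0 ∨ l.1 i = 1 := by omega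
    all_goals simp [hi]
  have := two_mul_sum_mul_sum_Iic fun i => (l.1 i : ℕ)
  simp only [letter_sq, l.2] at this
  rw [← length_add_sum_mul_prefixSum, mul_add, ← this]
  rfl

theorem GE.length_le (h : GE m l) : l.length ≤ m.length := by
  have := sum_le_sum fun j (_ : j ∈ univ) => h j
  have hl := l.two_mul_length_add
  have hm := m.two_mul_length_add
  simp only [prefixSum] at hl hm
  omega

theorem GE.eq_of_length_le (h : GE m l) (hlen : m.length ≤ l.length) : m = l := by
  have hsum : ∑ j, l.prefixSum j = ∑ j, m.prefixSum j := by
    have hl := l.two_mul_length_add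
    have hm := m.two_mul_length_add
    rw [le_antisymm hlen h.length_le] at hm
    omega
  have := (sum_eq_sum_iff_of_le fun j _ => h j).1 hsum
  exact h.antisymm fun j => (this j (mem_univ j)).ge

theorem length_act_swap_lt {a b : Fin N} (hab : a ≤ b) (hl : l.1 b < l.1 a) :
    (act (Equiv.swap a b) l).length < l.length := by
  refine lt_of_not_ge fun hlen => hl.ne ?_
  rw [← act_swap_apply_left, ← (ge_act_swap hab hl.le).eq_of_length_le hlen]

end Length

section Inversions

variable {w : Equiv.Perm (Fin N)} {l : Word N n} {i j : Fin N}

theorem mem_inv {p : Fin N × Fin N} :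
    p ∈ inv w l ↔ w⁻¹ p.1 < w⁻¹ p.2 ∧ l.1 p.2 < l.1 p.1 :=
  mem_filter_univ p

theorem inv_mul_act (v w : Equiv.Perm (Fin N)) (l : Word N n) :
    inv (v * w) (act v l) = (inv w l).map (v.prodCongr v).toEmbedding := by
  ext p
  simp [mem_inv, act_apply, mem_map_equiv]

theorem card_inv (w : Equiv.Perm (Fin N)) (l : Word N n) :
    #(inv w l) = length (act w⁻¹ l) := by
  have := inv_mul_act w 1 (act w⁻¹ l)
  rw [act_act, mul_inv_cancel, act_one, mul_one] at this
  rw [this, card_map]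
  rfl

theorem notMem_inv_of_lt (hij : i < j) : (w j, w i) ∉ inv w l := by
  simp [mem_inv, hij.le]

theorem inv_mul_swap (hij : i ⋖ j) (hl : l.1 (w i) < l.1 (w j)) :
    inv (w * Equiv.swap i j) l = insert (w j, w i) (inv w l) := by
  ext ⟨a, b⟩
  simp only [mem_inv, mem_insert, mul_inv_rev, Equiv.swap_inv, Equiv.Perm.mul_apply,
    swap_lt_swap_iff_of_covBy hij, Equiv.Perm.inv_eq_iff_eq, Prod.mk.injEq]
  grind

theorem length_act_swap (hij : i ⋖ j) (hl : l.1 i < l.1 j) :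
    (act (Equiv.swap i j) l).length = l.length + 1 := by
  have := congrArg card (inv_mul_swap (w := 1) hij hl)
  rwa [card_insert_of_notMem (notMem_inv_of_lt hij.lt), one_mul, card_inv, card_inv,
    Equiv.swap_inv] at this

theorem inv_one_of_monotone (hl : Monotone l.1) : inv 1 l = ∅ :=
  filter_eq_empty_iff.2 fun _ _ hp => (hl (le_of_lt hp.1)).not_gt hp.2

theorem length_eq_zero_of_monotone (hl : Monotone l.1) : l.length = 0 :=
  (card_inv 1 l).symm.trans (by rw [inv_one_of_monotone hl, card_empty])

end Inversions

section Induction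

variable {motive : Word N n → Prop}

theorem ascent_induction (antitone : ∀ l : Word N n, Antitone l.1 → motive l)
    (ascent : ∀ (l : Word N n) (i j : Fin N), i ⋖ j → l.1 i < l.1 j →
      motive (act (Equiv.swap i j) l) → motive l) (l : Word N n) : motive l := by
  have bound (l : Word N n) : l.length ≤ Fintype.card (Fin N × Fin N) := card_le_univ _
  induction hk : Fintype.card (Fin N × Fin N) - l.length using Nat.strong_induction_on
    generalizing l with
  | h k ih =>
    by_cases hl : Antitone l.1
    · exact antitone l hl
    rw [antitone_iff_forall_covBy] at hl
    push Not at hl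
    obtain ⟨i, j, hij, hlt⟩ := hl
    have hlen := length_act_swap hij hlt
    have := bound (act (Equiv.swap i j) l)
    exact ascent l i j hij hlt (ih _ (by omega) _ rfl)

theorem descent_induction (monotone : ∀ l : Word N n, Monotone l.1 → motive l)
    (ascent : ∀ (l : Word N n) (i j : Fin N), i ⋖ j → l.1 i < l.1 j →
      motive l → motive (act (Equiv.swap i j) l)) (l : Word N n) : motive l := by
  induction hk : l.length using Nat.strong_induction_on generalizing l with
  | h k ih =>
    by_cases hl : Monotone l.1
    · exact monotone l hl
    rw [monotone_iff_forall_covBy] at hl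
    push Not at hl
    obtain ⟨i, j, hij, hlt⟩ := hl
    rw [← act_swap_act_swap i j l]
    refine ascent _ i j hij (by rwa [act_swap_apply_left, act_swap_apply_right]) (ih _ ?_ _ rfl)
    exact hk ▸ length_act_swap_lt hij.le hlt

end Induction

end Word

/-! ### Products over inversions -/

section InvProd

variable {w : Equiv.Perm (Fin N)} {l : Word N n} {i j : Fin N}

/-- The product of the weights `t_a - t_b` over the `w`-twisted inversions `(a, b)` of `l`, i.e. the
value at `l` of the `w`-twisted Schubert class of `l`. -/
noncomputable def invProd (w : Equiv.Perm (Fin N)) (l : Word N n) : P N :=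
  ∏ p ∈ Word.inv w l, (X p.1 - X p.2)

theorem fst_ne_snd_of_mem_inv {p : Fin N × Fin N} (hp : p ∈ Word.inv w l) : p.1 ≠ p.2 :=
  fun h => (Word.mem_inv.1 hp).1.ne (congrArg _ h)

theorem invProd_ne_zero (w : Equiv.Perm (Fin N)) (l : Word N n) : invProd w l ≠ 0 :=
  prod_ne_zero_iff.2 fun _ hp => X_sub_X_ne_zero (fst_ne_snd_of_mem_inv hp)

theorem isHomogeneous_invProd (w : Equiv.Perm (Fin N)) (l : Word N n) :
    (invProd w l).IsHomogeneous (Word.act w⁻¹ l).length := by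
  rw [← Word.card_inv, card_eq_sum_ones]
  exact IsHomogeneous.prod _ _ _ fun p _ => isHomogeneous_X_sub_X p.1 p.2

theorem rename_invProd (v w : Equiv.Perm (Fin N)) (l : Word N n) :
    rename v (invProd w l) = invProd (v * w) (Word.act v l) := by
  simp [invProd, Word.inv_mul_act, map_prod]

theorem invProd_mul_swap (hij : i ⋖ j) (hl : l.1 (w i) < l.1 (w j)) :
    invProd (w * Equiv.swap i j) l = (X (w j) - X (w i)) * invProd w l := by
  rw [invProd, Word.inv_mul_swap hij hl, prod_insert (Word.notMem_inv_of_lt hij.lt), invProd]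

theorem invProd_dvd {f : P N} (h : ∀ p ∈ Word.inv w l, (X p.1 - X p.2 : P N) ∣ f) :
    invProd w l ∣ f := by
  refine prod_dvd_of_isRelPrime (fun p hp q hq hpq => ?_) h
  refine (prime_X_sub_X (fst_ne_snd_of_mem_inv hp)).irreducible.isRelPrime_iff_not_dvd.2
    fun hdvd => ?_
  rcases Sym2.mk_eq_mk_iff.1 (sym2_eq_of_X_sub_X_dvd (fst_ne_snd_of_mem_inv hq) hdvd) with h | h
  · exact hpq h
  · rw [h] at hp
    exact (Word.mem_inv.1 hp).1.asymm (Word.mem_inv.1 hq).1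

theorem X_sub_X_dvd_invProd (hl : Antitone l.1) (hij : l.1 i ≠ l.1 j) :
    (X i - X j : P N) ∣ invProd 1 l := by
  have dvd_of_lt {a b : Fin N} (hab : a < b) (hne : l.1 a ≠ l.1 b) :
      (X a - X b : P N) ∣ invProd 1 l :=
    dvd_prod_of_mem (fun p : Fin N × Fin N => (X p.1 - X p.2 : P N)) (a := (a, b))
      (Word.mem_inv.2 ⟨hab, (hl hab.le).lt_of_ne' hne⟩)
  rcases lt_or_gt_of_ne (ne_of_apply_ne _ hij) with h | h
  · exact dvd_of_lt h hij
  · rw [← neg_sub, neg_dvd]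
    exact dvd_of_lt h hij.symm

end InvProd

/-! ### Classes and divided differences -/

theorem single_mem_HT {l : Word N n} {f : P N}
    (hf : ∀ i j, l.1 i ≠ l.1 j → (X i - X j : P N) ∣ f) : Pi.single l f ∈ HT N n := by
  intro i j _ m
  by_cases hm : m.1 i = m.1 j
  · rw [Word.act_swap_of_eq hm, sub_self]
    exact dvd_zero _
  have dvd_single {k : Word N n} (hk : k.1 i ≠ k.1 j) :
      (X i - X j : P N) ∣ (Pi.single l f : Word N n → P N) k := by
    rcases eq_or_ne k l with rfl | hkl
    · rw [Pi.single_eq_same]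
      exact hf i j hk
    · rw [Pi.single_eq_of_ne hkl]
      exact dvd_zero _
  refine dvd_sub (dvd_single hm) (dvd_single ?_)
  rw [Word.act_swap_apply_left, Word.act_swap_apply_right]
  exact Ne.symm hm

theorem HT.invProd_dvd {α : Word N n → P N} (hα : α ∈ HT N n) (w : Equiv.Perm (Fin N))
    {l : Word N n}
    (h : ∀ m : Word N n, (Word.act w⁻¹ m).length < (Word.act w⁻¹ l).length → α m = 0) :
    invProd w l ∣ α l := by
  refine WallCrossing.invProd_dvd fun p hp => ?_
  obtain ⟨hlt, hdesc⟩ := Word.mem_inv.1 hp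
  have hzero : α (Word.act (Equiv.swap p.1 p.2) l) = 0 := by
    refine h _ ?_
    rw [Word.act_act, Equiv.mul_swap_eq_swap_mul, ← Word.act_act]
    exact Word.length_act_swap_lt hlt.le (by simpa [Word.act_apply] using hdesc)
  simpa only [hzero, sub_zero] using hα p.1 p.2 (fst_ne_snd_of_mem_inv hp) l

theorem HT.eq_zero_of_totalDegree_lt {α : Word N n → P N} (hα : α ∈ HT N n)
    (h : ∀ m, α m ≠ 0 → (α m).totalDegree < m.length) : α = 0 := by
  funext m
  induction hk : m.length using Nat.strong_induction_on generalizing m with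
  | h k ih =>
    by_contra hne
    obtain ⟨g, hg⟩ := HT.invProd_dvd hα 1 (l := m) fun m' hm' => ih _ (hk ▸ hm') m' rfl
    have hg0 : g ≠ 0 := fun h0 => hne (by rw [hg, h0, mul_zero, Pi.zero_apply])
    have hdeg : (invProd 1 m).totalDegree = m.length :=
      (isHomogeneous_invProd 1 m).totalDegree (invProd_ne_zero 1 m)
    have := h m hne
    rw [hg, totalDegree_mul_of_isDomain (invProd_ne_zero 1 m) hg0, hdeg] at this
    omega

section Twist

/-- The action of a permutation on functions `Λ_n → P`, on words and on variables at once. -/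
noncomputable def twist (w : Equiv.Perm (Fin N)) (α : Word N n → P N) : Word N n → P N :=
  fun m => rename w (α (Word.act w⁻¹ m))

theorem twist_apply (w : Equiv.Perm (Fin N)) (α : Word N n → P N) (m : Word N n) :
    twist w α m = rename w (α (Word.act w⁻¹ m)) := rfl

theorem twist_swap_apply (i j : Fin N) (α : Word N n → P N) (m : Word N n) :
    twist (Equiv.swap i j) α m = rename (Equiv.swap i j) (α (Word.act (Equiv.swap i j) m)) := by
  rw [twist_apply, Equiv.swap_inv]

theorem twist_mul (w v : Equiv.Perm (Fin N)) (α : Word N n → P N) :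
    twist (w * v) α = twist w (twist v α) := by
  funext m
  rw [twist_apply, twist_apply, twist_apply, rename_rename, Word.act_act, mul_inv_rev]
  rfl

theorem twist_one (α : Word N n → P N) : twist 1 α = α := by
  funext m
  rw [twist_apply, inv_one, Word.act_one, Equiv.Perm.coe_one, rename_id_apply]

theorem twist_zero (w : Equiv.Perm (Fin N)) : twist w (0 : Word N n → P N) = 0 :=
  funext fun _ => map_zero _

theorem twist_add (w : Equiv.Perm (Fin N)) (α β : Word N n → P N) :
    twist w (α + β) = twist w α + twist w β :=
  funext fun _ => map_add _ _ _

theorem twist_smul (w : Equiv.Perm (Fin N)) (c : P N) (α : Word N n → P N) :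
    twist w (c • α) = rename w c • twist w α :=
  funext fun _ => map_mul _ _ _

theorem twist_mem_HT (w : Equiv.Perm (Fin N)) {α : Word N n → P N} (hα : α ∈ HT N n) :
    twist w α ∈ HT N n := by
  intro i j hij l
  have hdvd := map_dvd (rename w) (hα _ _ (w⁻¹.injective.ne hij) (Word.act w⁻¹ l))
  simpa [twist_apply, Equiv.mul_swap_eq_swap_mul] using hdvd

end Twist

/-- `β` is the divided difference `(α - s α) / (t_i - t_j)`, where `s` is the transposition of `i`
and `j` acting by `twist`; stated without division. -/
def IsDividedDifference (i j : Fin N) (α β : Word N n → P N) : Prop :=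
  ∀ m, (X i - X j) * β m = α m - twist (Equiv.swap i j) α m

namespace IsDividedDifference

variable {i j : Fin N} {α β : Word N n → P N}

theorem exists_of_mem_HT (hα : α ∈ HT N n) (hij : i ≠ j) : ∃ β, IsDividedDifference i j α β := by
  have hdvd (m : Word N n) : (X i - X j : P N) ∣ α m - twist (Equiv.swap i j) α m := by
    have := dvd_add (hα i j hij m)
      (X_sub_X_dvd_sub_rename_swap i j (α (Word.act (Equiv.swap i j) m)))
    rwa [sub_add_sub_cancel, ← twist_swap_apply] at this
  choose β hβ using hdvd
  exact ⟨β, fun m => (hβ m).symm⟩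

theorem dvd_sub_act_swap (h : IsDividedDifference i j α β) (hα : α ∈ HT N n) (hij : i ≠ j)
    (l : Word N n) : (X i - X j : P N) ∣ β l - β (Word.act (Equiv.swap i j) l) := by
  obtain ⟨q, hq⟩ := hα i j hij l
  suffices β l - β (Word.act (Equiv.swap i j) l) = q - rename (Equiv.swap i j) q from
    this ▸ X_sub_X_dvd_sub_rename_swap i j q
  have hl := h l
  have hsl := h (Word.act (Equiv.swap i j) l)
  rw [twist_swap_apply] at hl hsl
  rw [Word.act_swap_act_swap] at hsl
  have hsq := congrArg (rename (Equiv.swap i j)) hq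
  rw [map_sub, map_mul, map_sub, rename_X, rename_X, Equiv.swap_apply_left,
    Equiv.swap_apply_right] at hsq
  refine mul_left_cancel₀ (X_sub_X_ne_zero hij) ?_
  linear_combination hl - hsl + hq + hsq

theorem mem_HT (h : IsDividedDifference i j α β) (hα : α ∈ HT N n) (hij : i ≠ j) :
    β ∈ HT N n := by
  intro a b hab l
  by_cases hpair : s(a, b) = s(i, j)
  · rcases Sym2.eq_iff.1 hpair with ⟨rfl, rfl⟩ | ⟨rfl, rfl⟩
    · exact h.dvd_sub_act_swap hα hij l
    · rw [Equiv.swap_comm, ← neg_sub, neg_dvd]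
      exact h.dvd_sub_act_swap hα hij l
  have hmul : (X a - X b : P N) ∣ (X i - X j) * (β l - β (Word.act (Equiv.swap a b) l)) := by
    rw [mul_sub, h, h, sub_sub_sub_comm]
    exact dvd_sub (hα a b hab l) (twist_mem_HT _ hα a b hab l)
  exact ((prime_X_sub_X hab).dvd_or_dvd hmul).resolve_left
    fun hdvd => hpair (sym2_eq_of_X_sub_X_dvd hij hdvd)

theorem ge_of_ne_zero (h : IsDividedDifference i j α β) (hij : i ⋖ j) {l : Word N n}
    (hl : l.1 i ≤ l.1 j) (hα : ∀ m, α m ≠ 0 → Word.GE m l) {m : Word N n} (hm : β m ≠ 0) :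
    Word.GE m l := by
  by_cases hαm : α m = 0
  · rw [← Word.act_swap_act_swap i j m]
    refine (hα _ fun hsm => ?_).act_swap_left hij hl
    have := h m
    rw [twist_swap_apply, hαm, hsm, map_zero, sub_zero] at this
    exact mul_ne_zero (X_sub_X_ne_zero hij.ne) hm this
  · exact hα m hαm

theorem totalDegree_lt (h : IsDividedDifference i j α β) (hij : i ≠ j) {d : ℕ}
    (hα : ∀ m, (α m).totalDegree ≤ d) {m : Word N n} (hm : β m ≠ 0) :
    (β m).totalDegree < d := by
  have hmul := totalDegree_mul_of_isDomain (X_sub_X_ne_zero hij) hm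
  rw [(isHomogeneous_X_sub_X i j).totalDegree (X_sub_X_ne_zero hij), h m] at hmul
  have htwist : (twist (Equiv.swap i j) α m).totalDegree ≤ d :=
    (totalDegree_rename_le _ _).trans (hα _)
  have := (totalDegree_sub _ _).trans (max_le (hα m) htwist)
  omega

end IsDividedDifference

/-! ### Untwisted Schubert classes -/

/-- A characterisation of the untwisted Schubert class of `l` that bounds the degree from above
only; the degree is then automatically exact on the support. -/
structure IsSchubert (l : Word N n) (α : Word N n → P N) : Prop where
  mem : α ∈ HT N n
  support : ∀ m, α m ≠ 0 → Word.GE m l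
  value : α l = invProd 1 l
  degree : ∀ m, (α m).totalDegree ≤ l.length

namespace IsSchubert

variable {l m : Word N n} {i j : Fin N} {α β : Word N n → P N}

theorem eq_zero_of_length_le (h : IsSchubert l α) (hm : m.length ≤ l.length) (hne : m ≠ l) :
    α m = 0 := by
  by_contra h0
  exact hne ((h.support m h0).eq_of_length_le hm)

theorem unique (hα : IsSchubert l α) (hβ : IsSchubert l β) : α = β := by
  refine sub_eq_zero.1 (HT.eq_zero_of_totalDegree_lt (sub_mem hα.mem hβ.mem) fun m hm => ?_)
  have hlt : l.length < m.length := by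
    by_contra! hle
    refine hm (sub_eq_zero.2 ?_)
    rcases eq_or_ne m l with rfl | hne
    · rw [hα.value, hβ.value]
    · rw [hα.eq_zero_of_length_le hle hne, hβ.eq_zero_of_length_le hle hne]
  exact ((totalDegree_sub _ _).trans (max_le (hα.degree m) (hβ.degree m))).trans_lt hlt

theorem of_antitone (hl : Antitone l.1) : IsSchubert l (Pi.single l (invProd 1 l)) where
  mem := single_mem_HT fun _ _ => X_sub_X_dvd_invProd hl
  support m hm := by
    obtain rfl : m = l := by
      by_contra h
      exact hm (Pi.single_eq_of_ne h _)
    exact Word.GE.refl m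
  value := Pi.single_eq_same l _
  degree m := by
    rcases eq_or_ne m l with rfl | hm
    · rw [Pi.single_eq_same]
      exact (isHomogeneous_invProd 1 m).totalDegree_le
    · rw [Pi.single_eq_of_ne hm, totalDegree_zero]
      exact Nat.zero_le _

theorem of_isDividedDifference (h : IsSchubert (Word.act (Equiv.swap i j) l) α) (hij : i ⋖ j)
    (hl : l.1 i < l.1 j) (hβ : IsDividedDifference i j α β) : IsSchubert l β where
  mem := hβ.mem_HT h.mem hij.ne
  support m hm := by
    have act_ge : Word.GE (Word.act (Equiv.swap i j) l) l := by
      simpa using (Word.GE.refl l).act_swap_left hij hl.le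
    exact hβ.ge_of_ne_zero hij hl.le (fun m hm => (h.support m hm).trans act_ge) hm
  value := by
    have hlen := Word.length_act_swap hij hl
    have hαl : α l = 0 := h.eq_zero_of_length_le (by omega) fun e => by rw [← e] at hlen; omega
    have hprod : rename (Equiv.swap i j) (invProd 1 (Word.act (Equiv.swap i j) l)) =
        (X j - X i) * invProd 1 l := by
      rw [rename_invProd, Word.act_swap_act_swap, mul_one]
      exact invProd_mul_swap (w := 1) hij hl
    refine mul_left_cancel₀ (X_sub_X_ne_zero hij.ne) ?_
    rw [hβ l, twist_swap_apply, hαl, h.value, hprod]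
    ring
  degree m := by
    rcases eq_or_ne (β m) 0 with h0 | h0
    · simp [h0]
    · have := hβ.totalDegree_lt hij.ne h.degree h0
      rw [Word.length_act_swap hij hl] at this
      omega

end IsSchubert

theorem exists_isSchubert (l : Word N n) : ∃ α, IsSchubert l α := by
  induction l using Word.ascent_induction with
  | antitone l hl => exact ⟨_, .of_antitone hl⟩
  | ascent l i j hij hl ih =>
    obtain ⟨α, hα⟩ := ih
    obtain ⟨β, hβ⟩ := IsDividedDifference.exists_of_mem_HT hα.mem hij.ne
    exact ⟨β, hα.of_isDividedDifference hij hl hβ⟩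

/-- The untwisted equivariant Schubert class of `l`. -/
noncomputable def schubert (l : Word N n) : Word N n → P N :=
  (exists_isSchubert l).choose

theorem isSchubert_schubert (l : Word N n) : IsSchubert l (schubert l) :=
  (exists_isSchubert l).choose_spec

theorem isDividedDifference_schubert {l : Word N n} {i j : Fin N} (hij : i ⋖ j)
    (hl : l.1 i < l.1 j) :
    IsDividedDifference i j (schubert (Word.act (Equiv.swap i j) l)) (schubert l) := by
  have h := isSchubert_schubert (Word.act (Equiv.swap i j) l)
  obtain ⟨β, hβ⟩ := IsDividedDifference.exists_of_mem_HT h.mem hij.ne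
  rwa [(isSchubert_schubert l).unique (h.of_isDividedDifference hij hl hβ)]

theorem twist_swap_schubert_of_le {l : Word N n} {i j : Fin N} (hij : i ⋖ j)
    (hl : l.1 i ≤ l.1 j) : twist (Equiv.swap i j) (schubert l) = schubert l := by
  have h := isSchubert_schubert l
  obtain ⟨β, hβ⟩ := IsDividedDifference.exists_of_mem_HT h.mem hij.ne
  have hzero : β = 0 := HT.eq_zero_of_totalDegree_lt (hβ.mem_HT h.mem hij.ne) fun m hm =>
    (hβ.totalDegree_lt hij.ne h.degree hm).trans_le
      (hβ.ge_of_ne_zero hij hl h.support hm).length_le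
  funext m
  have := hβ m
  rw [hzero, Pi.zero_apply, mul_zero] at this
  exact (sub_eq_zero.1 this.symm).symm

theorem twist_swap_schubert (l : Word N n) {i j : Fin N} (hij : i ⋖ j) :
    twist (Equiv.swap i j) (schubert l) = schubert l +
      if l.1 j < l.1 i then (X j - X i : P N) • schubert (Word.act (Equiv.swap i j) l) else 0 := by
  split_ifs with hl
  · have h := isDividedDifference_schubert (l := Word.act (Equiv.swap i j) l) hij
      (by rwa [Word.act_swap_apply_left, Word.act_swap_apply_right])
    rw [Word.act_swap_act_swap] at h
    funext m
    simp only [Pi.add_apply, Pi.smul_apply, smul_eq_mul]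
    linear_combination h m
  · rw [add_zero, twist_swap_schubert_of_le hij (not_lt.1 hl)]

/-! ### Homogeneity and positivity of the localisations -/

section Localisation

variable {l m : Word N n} {i j : Fin N}

theorem schubert_apply_act_swap (l m : Word N n) (hij : i ⋖ j) :
    schubert l (Word.act (Equiv.swap i j) m) = rename (Equiv.swap i j) (schubert l m +
      if l.1 j < l.1 i then (X j - X i) * schubert (Word.act (Equiv.swap i j) l) m else 0) := by
  have h := congrFun (twist_swap_schubert l hij) m
  rw [twist_swap_apply] at h
  have involutive := congrFun (twist_one (schubert l)) (Word.act (Equiv.swap i j) m)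
  rw [← Equiv.swap_mul_self i j, twist_mul, twist_swap_apply, Word.act_swap_act_swap,
    twist_swap_apply, h] at involutive
  rw [← involutive]
  split_ifs <;> rfl

theorem schubert_apply_of_monotone (l : Word N n) (hm : Monotone m.1) :
    schubert l m = if m = l then 1 else 0 := by
  have h := isSchubert_schubert l
  have hinv := Word.inv_one_of_monotone hm
  split_ifs with hml
  · subst hml
    rw [h.value, invProd, hinv, prod_empty]
  · exact h.eq_zero_of_length_le (by simp [Word.length_eq_zero_of_monotone hm]) hml

theorem isHomogeneous_schubert (l m : Word N n) : (schubert l m).IsHomogeneous l.length := by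
  induction m using Word.descent_induction generalizing l with
  | monotone m hm =>
    rw [schubert_apply_of_monotone l hm]
    split_ifs with hml
    · rw [← hml, Word.length_eq_zero_of_monotone hm]
      exact isHomogeneous_one _ _
    · exact isHomogeneous_zero _ _ _
  | ascent m i j hij _ ih =>
    rw [schubert_apply_act_swap l m hij]
    refine ((ih l).add ?_).rename_isHomogeneous
    split_ifs with hl
    · have hlen := Word.length_act_swap (l := Word.act (Equiv.swap i j) l) hij
        (by rwa [Word.act_swap_apply_left, Word.act_swap_apply_right])
      rw [Word.act_swap_act_swap] at hlen
      rw [hlen, add_comm]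
      exact (isHomogeneous_X_sub_X j i).mul (ih _)
    · exact isHomogeneous_zero _ _ _

/-- The word `m` as a point of `ℂ^N`, at which localisations at `m` are evaluated. -/
def Word.point (m : Word N n) (a : Fin N) : ℂ := (m.1 a : ℕ)

theorem Word.point_act_swap_comp (m : Word N n) (i j : Fin N) :
    (Word.act (Equiv.swap i j) m).point ∘ Equiv.swap i j = m.point := by
  funext a
  simp [Word.point, Word.act_apply]

theorem eval_schubert_apply_act_swap (l : Word N n) (hij : i ⋖ j) (hm : m.1 i < m.1 j) :
    eval (Word.act (Equiv.swap i j) m).point (schubert l (Word.act (Equiv.swap i j) m)) =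
      eval m.point (schubert l m) + if l.1 j < l.1 i then
        eval m.point (schubert (Word.act (Equiv.swap i j) l) m) else 0 := by
  obtain ⟨hi, hj⟩ : m.1 i = 0 ∧ m.1 j = 1 := by omega
  rw [schubert_apply_act_swap l m hij, eval_rename, Word.point_act_swap_comp, map_add]
  split_ifs
  · simp [Word.point, hi, hj]
  · rw [map_zero]

open scoped ComplexOrder

theorem eval_schubert_nonneg (l m : Word N n) : 0 ≤ eval m.point (schubert l m) := by
  induction m using Word.descent_induction generalizing l with
  | monotone m hm =>
    rw [schubert_apply_of_monotone l hm]
    split_ifs <;> simp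
  | ascent m i j hij hm ih =>
    rw [eval_schubert_apply_act_swap l hij hm]
    refine add_nonneg (ih l) ?_
    split_ifs
    exacts [ih _, le_rfl]

theorem eval_schubert_pos (h : Word.GE m l) : 0 < eval m.point (schubert l m) := by
  induction m using Word.descent_induction generalizing l with
  | monotone m hm =>
    obtain rfl := h.eq_of_length_le (by simp [Word.length_eq_zero_of_monotone hm])
    simp [schubert_apply_of_monotone m hm]
  | ascent m i j hij hm ih =>
    rw [eval_schubert_apply_act_swap l hij hm]
    split_ifs with hl
    · have hge := (h.trans (Word.ge_act_swap hij.le hl.le)).act_swap_left hij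
        (by rw [Word.act_swap_apply_left, Word.act_swap_apply_right]; exact hl.le)
      rw [Word.act_swap_act_swap] at hge
      exact add_pos_of_nonneg_of_pos (eval_schubert_nonneg l m) (ih hge)
    · have hge := h.act_swap_left hij (not_lt.1 hl)
      rw [Word.act_swap_act_swap] at hge
      exact add_pos_of_pos_of_nonneg (ih hge) le_rfl

theorem totalDegree_schubert (h : Word.GE m l) : (schubert l m).totalDegree = l.length := by
  refine (isHomogeneous_schubert l m).totalDegree fun h0 => (eval_schubert_pos h).ne' ?_
  rw [h0, map_zero]

end Localisation

/-! ### Twisted Schubert classes -/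

section Twisted

variable {w : Equiv.Perm (Fin N)} {l m : Word N n} {α : Word N n → P N}

theorem Word.twistedGE_mul_act {v : Equiv.Perm (Fin N)} :
    Word.twistedGE (v * w) m (Word.act v l) ↔ Word.twistedGE w (Word.act v⁻¹ m) l := by
  simp [Word.twistedGE]

theorem IsTwistedSchubertClass.twist (h : IsTwistedSchubertClass w l α)
    (v : Equiv.Perm (Fin N)) :
    IsTwistedSchubertClass (v * w) (Word.act v l) (WallCrossing.twist v α) := by
  have rename_ne_zero {f : P N} : rename v f ≠ 0 ↔ f ≠ 0 :=
    map_ne_zero_iff _ (rename_injective _ v.injective)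
  have apply_act : WallCrossing.twist v α (Word.act v l) = rename v (α l) := by
    simp [twist_apply]
  refine ⟨twist_mem_HT v h.isClass, ⟨?_, fun m hm => ?_⟩, ?_, fun m hm => ?_⟩
  · rw [apply_act, rename_ne_zero]
    exact h.support.1
  · exact Word.twistedGE_mul_act.2 (h.support.2 _ (rename_ne_zero.1 hm))
  · rw [apply_act, h.value]
    exact rename_invProd v w l
  · rw [twist_apply, ← renameEquiv_apply, totalDegree_renameEquiv,
      h.degree _ (Word.twistedGE_mul_act.1 hm)]
    simp

theorem isTwistedSchubertClass_one_iff : IsTwistedSchubertClass 1 l α ↔ α = schubert l := by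
  have hs := isSchubert_schubert l
  constructor
  · intro h
    refine IsSchubert.unique ⟨h.isClass, h.support.2, h.value, fun m => ?_⟩ hs
    rcases eq_or_ne (α m) 0 with h0 | h0
    · simp [h0]
    · exact (h.degree m (h.support.2 m h0)).le
  · rintro rfl
    exact ⟨hs.mem, ⟨hs.value ▸ invProd_ne_zero 1 l, hs.support⟩, hs.value,
      fun m hm => totalDegree_schubert hm⟩

theorem isTwistedSchubertClass_iff :
    IsTwistedSchubertClass w l α ↔ α = twist w (schubert (Word.act w⁻¹ l)) := by
  constructor
  · intro h
    have := h.twist w⁻¹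
    rw [inv_mul_cancel, isTwistedSchubertClass_one_iff] at this
    rw [← this, ← twist_mul, mul_inv_cancel, twist_one]
  · rintro rfl
    simpa using (isTwistedSchubertClass_one_iff (l := Word.act w⁻¹ l).2 rfl).twist w

theorem isTwistedSchubertClass_S (w : Equiv.Perm (Fin N)) (l : Word N n) :
    IsTwistedSchubertClass w l (S w l) :=
  Classical.epsilon_spec (p := IsTwistedSchubertClass w l) ⟨_, isTwistedSchubertClass_iff.2 rfl⟩

theorem S_eq_twist (w : Equiv.Perm (Fin N)) (l : Word N n) :
    S w l = twist w (schubert (Word.act w⁻¹ l)) :=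
  isTwistedSchubertClass_iff.1 (isTwistedSchubertClass_S w l)

theorem S_mul_swap (w : Equiv.Perm (Fin N)) {i j : Fin N} (hij : i ⋖ j) (l : Word N n) :
    S (w * Equiv.swap i j) l = S w (Word.act (w * Equiv.swap i j * w⁻¹) l) +
      if l.1 (w i) < l.1 (w j) then (X (w j) - X (w i) : P N) • S w l else 0 := by
  have h := congrArg (twist w)
    (twist_swap_schubert (Word.act (Equiv.swap i j) (Word.act w⁻¹ l)) hij)
  rw [Word.act_swap_act_swap, Word.act_swap_apply_left, Word.act_swap_apply_right, Word.act_apply,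
    Word.act_apply, inv_inv, ← twist_mul, twist_add, apply_ite (twist w), twist_smul, twist_zero,
    map_sub, rename_X, rename_X] at h
  simpa [S_eq_twist, mul_assoc] using h

theorem S_apply_eq_zero (hlen : (Word.act w⁻¹ m).length ≤ (Word.act w⁻¹ l).length) (hne : m ≠ l) :
    S w l m = 0 := by
  rw [S_eq_twist, twist_apply, (isSchubert_schubert _).eq_zero_of_length_le hlen, map_zero]
  intro h
  exact hne (by simpa using congrArg (Word.act w) h)

end Twisted

/-! ### Bases -/

theorem linearIndependent_S (w : Equiv.Perm (Fin N)) :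
    LinearIndependent (P N) (S w : Word N n → Word N n → P N) :=
  linearIndependent_of_triangular (rank := fun l => (Word.act w⁻¹ l).length)
    (fun _ _ => S_apply_eq_zero) fun l => (isTwistedSchubertClass_S w l).support.1

theorem span_range_S (w : Equiv.Perm (Fin N)) :
    Submodule.span (P N) (Set.range (S w : Word N n → Word N n → P N)) = HT N n := by
  have mem (l : Word N n) : S w l ∈ HT N n := (isTwistedSchubertClass_S w l).isClass
  refine le_antisymm (Submodule.span_le.2 (Set.range_subset_iff.2 mem)) ?_
  refine le_span_range_of_triangular (rank := fun l => (Word.act w⁻¹ l).length)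
    (fun _ _ => S_apply_eq_zero) mem fun α hα l h => ?_
  rw [(isTwistedSchubertClass_S w l).value]
  exact HT.invProd_dvd hα w h

/-- The basis of `HT N n` formed by the `w`-twisted Schubert classes. -/
noncomputable def schubertBasis (w : Equiv.Perm (Fin N)) :
    Module.Basis (Word N n) (P N) (HT N n) :=
  (Module.Basis.span (linearIndependent_S w)).map (LinearEquiv.ofEq _ _ (span_range_S w))

theorem coe_schubertBasis (w : Equiv.Perm (Fin N)) (l : Word N n) :
    (schubertBasis w l : Word N n → P N) = S w l := by
  rw [schubertBasis, Module.Basis.map_apply, LinearEquiv.coe_ofEq_apply, Module.Basis.span_apply]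

theorem schubertBasis_mul_swap (w : Equiv.Perm (Fin N)) {i j : Fin N} (hij : i ⋖ j)
    (l : Word N n) :
    schubertBasis (w * Equiv.swap i j) l =
      schubertBasis w (Word.act (w * Equiv.swap i j * w⁻¹) l) +
        if l.1 (w i) < l.1 (w j) then (X (w j) - X (w i) : P N) • schubertBasis w l else 0 := by
  refine Subtype.ext ?_
  simp only [Submodule.coe_add, apply_ite Subtype.val, Submodule.coe_smul, ZeroMemClass.coe_zero,
    coe_schubertBasis, S_mul_swap w hij]

/-! ### Base change by the `R`-matrix -/

theorem toLin'_single_basisFun {R ι κ : Type*} [CommRing R] [Fintype κ] [DecidableEq ι]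
    [DecidableEq κ] [Finite ι] (i : ι) (k x : κ) :
    Matrix.toLin' (Matrix.single i k (1 : R)) (Pi.basisFun R κ x) =
      if x = k then Pi.basisFun R ι i else 0 := by
  rw [Pi.basisFun_apply, Matrix.toLin'_apply, Matrix.mulVec_single_one]
  ext y
  split_ifs with h
  · simp [h, Matrix.single_apply, Pi.single_apply, eq_comm]
  · simp [Ne.symm h]

theorem onFactors_stdBasis {a b : Fin N} (hab : a ≠ b) (k l p q : Fin 2) (f : Fin N → Fin 2) :
    onFactors a b (Matrix.toLin' (Matrix.single k p (1 : P N)))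
        (Matrix.toLin' (Matrix.single l q (1 : P N))) (stdBasis N f) =
      if f a = p ∧ f b = q then
        stdBasis N (Function.update (Function.update f a k) b l) else 0 := by
  rw [onFactors, stdBasis, Basis.piTensorProduct_apply, PiTensorProduct.map_tprod]
  split_ifs with h
  · rw [Basis.piTensorProduct_apply]
    congr 1
    funext c
    rcases eq_or_ne c b with rfl | hb
    · rw [if_neg hab.symm, if_pos rfl, toLin'_single_basisFun, if_pos h.2, Function.update_self]
    rw [Function.update_of_ne hb]
    rcases eq_or_ne c a with rfl | ha
    · rw [if_pos rfl, toLin'_single_basisFun, if_pos h.1, Function.update_self]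
    · rw [if_neg ha, if_neg hb, Function.update_of_ne ha, LinearMap.id_apply]
  · rcases not_and_or.1 h with h | h
    · refine MultilinearMap.map_coord_zero _ a ?_
      rw [if_pos rfl, toLin'_single_basisFun, if_neg h]
    · refine MultilinearMap.map_coord_zero _ b ?_
      rw [if_neg hab.symm, if_pos rfl, toLin'_single_basisFun, if_neg h]

theorem actOnFactors_stdBasis {a b : Fin N} (hab : a ≠ b)
    (M : Matrix (Fin 2 × Fin 2) (Fin 2 × Fin 2) (P N)) (f : Fin N → Fin 2) :
    actOnFactors a b M (stdBasis N f) = ∑ k, ∑ l,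
      M (k, l) (f a, f b) • stdBasis N (Function.update (Function.update f a k) b l) := by
  simp only [actOnFactors, LinearMap.sum_apply, LinearMap.smul_apply, onFactors_stdBasis hab,
    ite_and, smul_ite, smul_zero, sum_ite_irrel, sum_const_zero, sum_ite_eq, mem_univ, if_true]

theorem RMatrix_apply {A : Type*} [CommRing A] (x y : A) (k l p q : Fin 2) :
    RMatrix x y (k, l) (p, q) =
      (if k = q ∧ l = p then 1 else 0) + if k = p ∧ l = q ∧ p < q then x - y else 0 := by
  fin_cases k <;> fin_cases l <;> fin_cases p <;> fin_cases q <;>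
    simp [RMatrix, finProdFinEquiv]

theorem actOnFactors_RMatrix_stdBasis {a b : Fin N} (hab : a ≠ b) (x y : P N)
    (f : Fin N → Fin 2) :
    actOnFactors a b (RMatrix x y) (stdBasis N f) =
      stdBasis N (f ∘ Equiv.swap a b) + if f a < f b then (x - y) • stdBasis N f else 0 := by
  rw [actOnFactors_stdBasis hab, Equiv.swap_comm a b, Equiv.comp_swap_eq_update]
  simp only [RMatrix_apply, add_smul, sum_add_distrib, ite_and, ite_smul, one_smul, zero_smul,
    sum_ite_irrel, sum_const_zero, sum_ite_eq', mem_univ, if_true, Function.update_eq_self]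

theorem actOnFactors_RMatrix_eq_sum_toMatrix (w : Equiv.Perm (Fin N)) {i j : Fin N} (hij : i ⋖ j)
    (l : Word N n) :
    actOnFactors (w i) (w j) (RMatrix (X (w j)) (X (w i))) (stdBasis N l.1) =
      ∑ m : Word N n, (schubertBasis w).toMatrix (schubertBasis (w * Equiv.swap i j)) m l •
        stdBasis N m.1 := by
  have hact : (Word.act (w * Equiv.swap i j * w⁻¹) l).1 = l.1 ∘ Equiv.swap (w i) (w j) := by
    rw [Equiv.mul_swap_eq_swap_mul, mul_inv_cancel_right]
    exact congrArg (l.1 ∘ ·) (congrArg _ (Equiv.swap_inv _ _))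
  have hconstr := (schubertBasis w).constr_apply_fintype (P N)
    (fun m : Word N n => stdBasis N m.1) (schubertBasis (w * Equiv.swap i j) l)
  simp only [Module.Basis.toMatrix_apply]
  simp only [Module.Basis.equivFun_apply] at hconstr
  rw [← hconstr, schubertBasis_mul_swap w hij, map_add, apply_ite (Module.Basis.constr _ _ _),
    map_smul, map_zero, Module.Basis.constr_basis, Module.Basis.constr_basis, hact]
  exact actOnFactors_RMatrix_stdBasis (w.injective.ne hij.ne) _ _ _

end WallCrossing

theorem proposition3p6 (N n : ℕ) (hN : 2 ≤ N) (hn : n ≤ N) :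
    -- the twisted Schubert classes are well defined
    (∀ (w : Equiv.Perm (Fin N)) (l : WallCrossing.Word N n),
      WallCrossing.IsTwistedSchubertClass w l (WallCrossing.S w l) ∧
      ∀ α : WallCrossing.Word N n → WallCrossing.P N,
        WallCrossing.IsTwistedSchubertClass w l α → α = WallCrossing.S w l) ∧
    -- wall-crossing for the simple transposition exchanging `i` and `j = i + 1`
    (∀ (w : Equiv.Perm (Fin N)) (i j : Fin N), (i : ℕ) + 1 = (j : ℕ) →
      ∀ l m : WallCrossing.Word N n,
        WallCrossing.S (w * Equiv.swap i j) l m =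
          if l.1 (w i) < l.1 (w j) then
            WallCrossing.S w (WallCrossing.Word.act (w * Equiv.swap i j * w⁻¹) l) m
              + (MvPolynomial.X (w j) - MvPolynomial.X (w i)) * WallCrossing.S w l m
          else
            WallCrossing.S w (WallCrossing.Word.act (w * Equiv.swap i j * w⁻¹) l) m) ∧
    -- every twisted family is a basis, and the base change is given by the `R`-matrix
    (∃ b : Equiv.Perm (Fin N) →
        Module.Basis (WallCrossing.Word N n) (WallCrossing.P N) (WallCrossing.HT N n),
      (∀ (w : Equiv.Perm (Fin N)) (l : WallCrossing.Word N n),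
        ((b w l : WallCrossing.HT N n) : WallCrossing.Word N n → WallCrossing.P N)
          = WallCrossing.S w l) ∧
      (∀ (w : Equiv.Perm (Fin N)) (i j : Fin N), (i : ℕ) + 1 = (j : ℕ) →
        ∀ l : WallCrossing.Word N n,
          WallCrossing.actOnFactors (w i) (w j)
              (WallCrossing.RMatrix (MvPolynomial.X (w j)) (MvPolynomial.X (w i)))
              (WallCrossing.stdBasis N l.1)
            = ∑ m : WallCrossing.Word N n,
                (b w).toMatrix (b (w * Equiv.swap i j)) m l • WallCrossing.stdBasis N m.1)) := by
  have covBy {i j : Fin N} (hij : (i : ℕ) + 1 = j) : i ⋖ j :=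
    Fin.covBy_iff.2 (Nat.covBy_iff_add_one_eq.2 hij)
  refine ⟨fun w l => ⟨WallCrossing.isTwistedSchubertClass_S w l, fun α hα => ?_⟩,
    fun w i j hij l m => ?_, WallCrossing.schubertBasis, WallCrossing.coe_schubertBasis,
    fun w i j hij => WallCrossing.actOnFactors_RMatrix_eq_sum_toMatrix w (covBy hij)⟩
  · rw [WallCrossing.isTwistedSchubertClass_iff.1 hα, WallCrossing.S_eq_twist]
  · rw [WallCrossing.S_mul_swap w (covBy hij)]
    split_ifs
    · rfl
    · rw [add_zero]
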